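/- Let $\kappa$ and $\lambda$ be infinite cardinals. The following are equivalent. (a) There is a graph with exactly $\lambda$ vertices whose chromatic number is $\kappa^+$ and which does not have the complete graph $K_{\kappa^+}$ on $\kappa^+$ vertices as a minor. (b) There is a tree $T$ of cardinality $\lambda$ which is not $\kappa$-special and in which there is no branch of length at least $\kappa^+$ (that is, every branch has order type less than $\kappa^+$). Here graphs are simple and undirected, and the chromatic number of a graph is the least cardinal $\mu$ for which it has a proper coloring with $\mu$ colors. A graph $H$ is a minor of a graph $G$ if there are pairwise disjoint non-empty sets $X_u\subseteq V(G)$, for $u\in V(H)$, each inducing a connected subgraph of $G$, such that for every edge $\{u,v\}$ of $H$ some edge of $G$ joins a vertex of $X_u$ to a vertex of $X_v$. A tree is a partially ordered set $(T,\le)$ (possibly with several minimal elements) in which $\{s\in T: s<t\}$ is well-ordered for every $t\in T$. A branch is a maximal chain of $T$, and its length is its order type. The tree $T$ is $\kappa$-special if there is a function $f:T\to\kappa$ whose restriction to every chain of $T$ is injective. -/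

import Mathlib

universe u v w

open Cardinal

namespace HadwigerTree

/-- The chromatic number of a graph as a cardinal: the least cardinal `μ` such that the graph has a
proper coloring with a set of `μ` colors. -/
noncomputable def chromaticCard {V : Type u} (G : SimpleGraph V) : Cardinal.{u} :=
  sInf {μ : Cardinal.{u} | Nonempty (G.Coloring μ.ord.ToType)}

/-- The infimum defining the chromatic number is over a nonempty set, so it is attained. -/
theorem nonempty_coloring_chromaticCard {V : Type u} (G : SimpleGraph V) :
    Nonempty (G.Coloring (chromaticCard G).ord.ToType) := by
  have hne : {μ : Cardinal.{u} | Nonempty (G.Coloring μ.ord.ToType)}.Nonempty := by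
    refine ⟨#V, ?_⟩
    have h : #V = #((#V).ord.ToType) := (Cardinal.mk_ord_toType _).symm
    obtain ⟨e⟩ := Cardinal.eq.1 h
    exact ⟨G.recolorOfEquiv e G.selfColoring⟩
  exact csInf_mem hne

/-- `H` is a minor of `G`: there are pairwise disjoint vertex sets of `G`, indexed by the vertices
of `H`, each inducing a connected (in particular nonempty) subgraph, such that adjacent vertices of
`H` have sets joined by an edge of `G`. -/
def IsMinor {W : Type w} {V : Type v} (H : SimpleGraph W) (G : SimpleGraph V) : Prop :=
  ∃ X : W → Set V,
    Pairwise (fun a b => Disjoint (X a) (X b)) ∧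
    (∀ a, (G.induce (X a)).Connected) ∧
    ∀ a b, H.Adj a b → ∃ x ∈ X a, ∃ y ∈ X b, G.Adj x y

/-- The complete graph on `κ` vertices. -/
def completeGraphCard (κ : Cardinal.{u}) : SimpleGraph κ.ord.ToType :=
  ⊤

/-- A (set-theoretic) tree: a partial order in which the set of strict predecessors of every
element is well-ordered. Several roots are allowed. -/
class IsOrderTree (T : Type u) [PartialOrder T] : Prop where
  isWellOrder_Iio : ∀ t : T, IsWellOrder (Set.Iio t) (· < ·)

/-- A tree is `κ`-special if there is a function to `κ` that is injective on chains. -/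
def IsSpecial (κ : Cardinal.{u}) (T : Type u) [PartialOrder T] : Prop :=
  ∃ f : T → κ.ord.ToType, ∀ C : Set T, IsChain (· ≤ ·) C → Set.InjOn f C

/-- A branch of a tree is a maximal chain. -/
def IsBranch {T : Type u} [PartialOrder T] (b : Set T) : Prop :=
  IsMaxChain (· ≤ ·) b

/-- The strict order of a tree is well-founded. -/
theorem wellFounded_lt (T : Type u) [PartialOrder T] [IsOrderTree T] :
    WellFounded (fun s t : T => s < t) := by
  refine ⟨fun t => Acc.intro t fun s hs => ?_⟩
  have key : ∀ x : Set.Iio t, Acc (fun s t : T => s < t) x.1 := by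
    intro x
    refine (IsOrderTree.isWellOrder_Iio t).wf.induction
      (C := fun x : Set.Iio t => Acc (fun s t : T => s < t) x.1) x ?_
    intro y ih
    exact Acc.intro _ fun z hz => ih ⟨z, lt_trans hz y.2⟩ hz
  exact key ⟨s, hs⟩

/-- Every branch of a tree is well-ordered. -/
theorem IsBranch.isWellOrder {T : Type u} [PartialOrder T] [IsOrderTree T] {b : Set T}
    (hb : IsBranch b) : IsWellOrder b (· < ·) where
  wf := InvImage.wf (fun x : b => x.1) (wellFounded_lt T)
  trichotomous := by
    intro x y hxy hyx
    rcases hb.isChain.total x.2 y.2 with h | h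
    · by_contra hn
      exact hxy (lt_of_le_of_ne h hn)
    · by_contra hn
      exact hyx (lt_of_le_of_ne h (fun e => hn e.symm))

/-- The length of a branch of a tree: its order type. -/
noncomputable def branchLength {T : Type u} [PartialOrder T] [IsOrderTree T] (b : Set T)
    (hb : IsBranch b) : Ordinal.{u} :=
  @Ordinal.type b (· < ·) hb.isWellOrder

end HadwigerTree

/-! From a tree, take the comparability graph. Proper `κ`-colorings specialize the tree, and ranks
in `κ⁺` give a coloring with `κ⁺` colors. Connected sets have least elements, and those of adjacent
branch sets are comparable, so a complete minor yields a chain of size `κ⁺`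
(`not_isMinor_comparabilityGraph`).

From a graph, remove at each stage below `κ⁺` a core from every remaining component: a connected set
of size at most `κ` meeting the neighborhood of each boundary vertex. Components that persist
through all stages would give the minor (`isMinor_of_avoidReachable`), so every vertex is removed.
Ordering vertices by removal time within components gives a tree with small chains and comparable
neighbors (`exists_normal_orderTree`); specializing it would color the graph. -/

namespace HadwigerTree

/-! ### Bounds and ranks in `κ⁺` -/

/-- The initial well-order of cardinality `κ⁺`. -/
abbrev SuccIndex (κ : Cardinal.{u}) : Type u := (Order.succ κ).ord.ToType

theorem mk_Iio_succIndex_le {κ : Cardinal.{u}} (i : SuccIndex κ) : #(Set.Iio i) ≤ κ := by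
  rw [← Order.lt_succ_iff]
  simpa using Cardinal.mk_Iio_lt i (by simp)

/-- This is the regularity of `κ⁺`. -/
theorem exists_gt_of_mk_le {κ : Cardinal.{u}} (hκ : ℵ₀ ≤ κ) {s : Set (SuccIndex κ)}
    (hs : #s ≤ κ) : ∃ i, ∀ j ∈ s, j < i := by
  by_contra! h
  have hreg := Cardinal.isRegular_succ hκ
  have h1 : Order.cof (SuccIndex κ) ≤ #s := Order.cof_le fun i => h i
  have h2 : Order.cof (SuccIndex κ) = Order.succ κ := by
    have := hreg.cof_ord
    simpa using this
  exact absurd (h2 ▸ h1.trans hs) (not_le.2 (Order.lt_succ κ))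

instance (κ : Cardinal.{u}) : Nonempty (SuccIndex κ) := by
  rw [Ordinal.nonempty_toType_iff, Ne, Cardinal.ord_eq_zero]
  exact (Order.bot_lt_succ κ).ne'

theorem exists_strictMono_succIndex {κ : Cardinal.{u}} (hκ : ℵ₀ ≤ κ) {T : Type u} [PartialOrder T]
    [IsOrderTree T] (h : ∀ t : T, #(Set.Iio t) ≤ κ) :
    ∃ f : T → SuccIndex κ, StrictMono f := by
  have hb (t : T) (g : Set.Iio t → SuccIndex κ) : ∃ i, ∀ s, g s < i := by
    obtain ⟨i, hi⟩ := exists_gt_of_mk_le hκ (mk_range_le.trans (h t) : #(Set.range g) ≤ κ)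
    exact ⟨i, fun s => hi _ ⟨s, rfl⟩⟩
  choose b hb using hb
  have wf := wellFounded_lt T
  refine ⟨wf.fix fun t g => b t fun s => g s.1 s.2, fun s t hst => ?_⟩
  conv_rhs => rw [wf.fix_eq]
  exact hb t (fun s => wf.fix (fun t g => b t fun s => g s.1 s.2) s.1) ⟨s, hst⟩

/-! ### Chains and comparability graphs -/

theorem branchLength_lt_ord_iff {T : Type u} [PartialOrder T] [IsOrderTree T] {b : Set T}
    (hb : IsBranch b) {c : Cardinal.{u}} : branchLength b hb < c.ord ↔ #b < c := by
  rw [branchLength, Cardinal.lt_ord, Ordinal.card_type]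

theorem mk_chain_le_of_branchLength_lt {κ : Cardinal.{u}} {T : Type u} [PartialOrder T]
    [IsOrderTree T]
    (h : ∀ (b : Set T) (hb : IsBranch b), branchLength b hb < (Order.succ κ).ord)
    {C : Set T} (hC : IsChain (· ≤ ·) C) : #C ≤ κ := by
  obtain ⟨b, hb, hCb⟩ := hC.exists_maxChain
  exact (mk_le_mk_of_subset hCb).trans
    (Order.lt_succ_iff.1 ((branchLength_lt_ord_iff hb).1 (h b hb)))

theorem isChain_Iio {T : Type u} [PartialOrder T] [IsOrderTree T] (t : T) :
    IsChain (· ≤ ·) (Set.Iio t) := by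
  intro a ha b hb hab
  have := IsOrderTree.isWellOrder_Iio t
  rcases trichotomous_of (· < ·) (⟨a, ha⟩ : Set.Iio t) ⟨b, hb⟩ with h | h | h
  · exact .inl h.le
  · exact absurd (congrArg Subtype.val h) hab
  · exact .inr h.le

theorem le_or_le_of_le_of_le {T : Type u} [PartialOrder T] [IsOrderTree T] {a b t : T}
    (ha : a ≤ t) (hb : b ≤ t) : a ≤ b ∨ b ≤ a := by
  rcases ha.eq_or_lt with rfl | ha
  · exact .inr hb
  rcases hb.eq_or_lt with rfl | hb
  · exact .inl ha.le
  exact (isChain_Iio t).total ha hb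

/-- The comparability graph of a partial order. -/
def comparabilityGraph (T : Type u) [PartialOrder T] : SimpleGraph T where
  Adj s t := s < t ∨ t < s
  symm := ⟨fun _ _ h => h.symm⟩
  loopless := ⟨fun _ h => h.elim (lt_irrefl _) (lt_irrefl _)⟩

/-- A graph whose chromatic number is at most `κ` has a proper coloring with `κ` colors. -/
theorem nonempty_coloring_iff {V : Type u} (G : SimpleGraph V) {κ : Cardinal.{u}} :
    Nonempty (G.Coloring κ.ord.ToType) ↔ chromaticCard G ≤ κ := by
  refine ⟨fun h => csInf_le' h, fun h => ?_⟩
  obtain ⟨c⟩ := nonempty_coloring_chromaticCard G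
  have h' : #(chromaticCard G).ord.ToType ≤ #κ.ord.ToType := by simpa using h
  obtain ⟨e⟩ := h'
  exact ⟨G.recolorOfEmbedding e c⟩

theorem isSpecial_of_coloring {κ : Cardinal.{u}} {T : Type u} [PartialOrder T]
    (c : (comparabilityGraph T).Coloring κ.ord.ToType) : IsSpecial κ T := by
  refine ⟨c, fun C hC a ha b hb hab => ?_⟩
  by_contra hne
  refine c.valid (v := a) (w := b) ?_ hab
  rcases hC.total ha hb with h | h
  · exact .inl (h.lt_of_ne hne)
  · exact .inr (h.lt_of_ne (Ne.symm hne))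

/-- A connected set of the comparability graph of a tree has a least element. -/
theorem exists_isLeast_of_connected {T : Type u} [PartialOrder T] [IsOrderTree T] {X : Set T}
    (hX : ((comparabilityGraph T).induce X).Connected) : ∃ m, IsLeast X m := by
  obtain ⟨⟨x, hx⟩⟩ := hX.nonempty
  obtain ⟨m, hm, hmin⟩ := (wellFounded_lt T).has_min X ⟨x, hx⟩
  refine ⟨m, hm, fun y hy => ?_⟩
  by_contra hmy
  obtain ⟨p⟩ := hX.preconnected ⟨m, hm⟩ ⟨y, hy⟩
  -- An edge leaving the cone above `m` must go down, to an element comparable with `m`, hence below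
  -- it, against minimality.
  obtain ⟨d, -, h1, h2⟩ := p.exists_boundary_dart {z | m ≤ z.1} le_rfl hmy
  have hadj : d.fst.1 < d.snd.1 ∨ d.snd.1 < d.fst.1 := d.adj
  rcases hadj with h | h
  · exact h2 (le_trans h1 h.le)
  · rcases le_or_le_of_le_of_le (show m ≤ d.fst.1 from h1) h.le with h' | h'
    · exact h2 h'
    · exact h2 (h'.eq_or_lt.resolve_right (hmin _ d.snd.2)).ge

theorem not_isMinor_comparabilityGraph {κ : Cardinal.{u}} {T : Type u} [PartialOrder T]
    [IsOrderTree T] (h : ∀ C : Set T, IsChain (· ≤ ·) C → #C ≤ κ) :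
    ¬ IsMinor (completeGraphCard (Order.succ κ)) (comparabilityGraph T) := by
  rintro ⟨X, hdis, hconn, hadj⟩
  choose m hm using fun a => exists_isLeast_of_connected (hconn a)
  have hinj : Function.Injective m := fun a b hab => by
    by_contra hne
    exact Set.disjoint_left.1 (hdis hne) (hm a).1 (hab ▸ (hm b).1)
  have hchain : IsChain (· ≤ ·) (Set.range m) := by
    rintro _ ⟨a, rfl⟩ _ ⟨b, rfl⟩ hne
    obtain ⟨x, hx, y, hy, hxy⟩ := hadj a b fun hab => hne (congrArg m hab)
    rcases hxy with hxy | hxy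
    · exact le_or_le_of_le_of_le (((hm a).2 hx).trans hxy.le) ((hm b).2 hy)
    · exact le_or_le_of_le_of_le ((hm a).2 hx) (((hm b).2 hy).trans hxy.le)
  have := h _ hchain
  rw [mk_range_eq _ hinj, mk_ord_toType] at this
  exact absurd this (not_le.2 (Order.lt_succ κ))

theorem chromaticCard_comparabilityGraph {κ : Cardinal.{u}} (hκ : ℵ₀ ≤ κ) {T : Type u}
    [PartialOrder T] [IsOrderTree T] (hs : ¬ IsSpecial κ T) (h : ∀ t : T, #(Set.Iio t) ≤ κ) :
    chromaticCard (comparabilityGraph T) = Order.succ κ := by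
  refine le_antisymm ?_ (Order.succ_le_of_lt (lt_of_not_ge fun hle => ?_))
  · obtain ⟨f, hf⟩ := exists_strictMono_succIndex hκ h
    exact (nonempty_coloring_iff _).1
      ⟨SimpleGraph.Coloring.mk f fun {a b} hab => hab.elim (fun h => (hf h).ne) fun h => (hf h).ne'⟩
  · obtain ⟨c⟩ := (nonempty_coloring_iff _).2 hle
    exact hs (isSpecial_of_coloring c)

/-! ### Components and removal of cores -/

section Avoiding

variable {V : Type u} (G : SimpleGraph V)

/-- There is a walk from `u` to `v` avoiding the set `U`. -/
def AvoidReachable (U : Set V) (u v : V) : Prop :=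
  ∃ p : G.Walk u v, ∀ x ∈ p.support, x ∉ U

variable {G}

theorem AvoidReachable.refl {U : Set V} {v : V} (h : v ∉ U) : AvoidReachable G U v v :=
  ⟨.nil, by simpa using h⟩

theorem AvoidReachable.symm {U : Set V} {u v : V} (h : AvoidReachable G U u v) :
    AvoidReachable G U v u := by
  obtain ⟨p, hp⟩ := h
  exact ⟨p.reverse, by simpa using hp⟩

theorem AvoidReachable.trans {U : Set V} {u v w : V} (h : AvoidReachable G U u v)
    (h' : AvoidReachable G U v w) : AvoidReachable G U u w := by
  obtain ⟨p, hp⟩ := h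
  obtain ⟨q, hq⟩ := h'
  refine ⟨p.append q, fun x hx => ?_⟩
  rw [SimpleGraph.Walk.mem_support_append_iff] at hx
  exact hx.elim (hp x) (hq x)

theorem AvoidReachable.mono {U U' : Set V} (hU : U ⊆ U') {u v : V}
    (h : AvoidReachable G U' u v) : AvoidReachable G U u v := by
  obtain ⟨p, hp⟩ := h
  exact ⟨p, fun x hx hxU => hp x hx (hU hxU)⟩

theorem AvoidReachable.notMem_left {U : Set V} {u v : V} (h : AvoidReachable G U u v) : u ∉ U := by
  obtain ⟨p, hp⟩ := h
  exact hp u p.start_mem_support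

theorem AvoidReachable.notMem_right {U : Set V} {u v : V} (h : AvoidReachable G U u v) : v ∉ U :=
  h.symm.notMem_left

theorem AvoidReachable.of_adj {U : Set V} {u v : V} (h : G.Adj u v) (hu : u ∉ U) (hv : v ∉ U) :
    AvoidReachable G U u v :=
  ⟨h.toWalk, by simp [hu, hv]⟩

theorem AvoidReachable.of_mem_support {U : Set V} {u v x : V} (p : G.Walk u v)
    (hp : ∀ x ∈ p.support, x ∉ U) (hx : x ∈ p.support) : AvoidReachable G U u x := by
  classical
  exact ⟨p.takeUntil x hx, fun y hy => hp y (p.support_takeUntil_subset_support hx hy)⟩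

variable (G)

/-- The component of `v` in the graph with `U` removed; it is empty if `v ∈ U`. -/
def avoidComponent (U : Set V) (v : V) : Set V := {w | AvoidReachable G U v w}

/-- The vertices outside `D` with a neighbor in `D`. -/
def outerBoundary (D : Set V) : Set V := {n | n ∉ D ∧ ∃ x ∈ D, G.Adj n x}

variable {G}

theorem avoidComponent_eq {U : Set V} {u v : V} (h : AvoidReachable G U u v) :
    avoidComponent G U u = avoidComponent G U v :=
  Set.ext fun _ => ⟨h.symm.trans, h.trans⟩

theorem outerBoundary_avoidComponent_subset (U : Set V) (v : V) :
    outerBoundary G (avoidComponent G U v) ⊆ U := by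
  rintro n ⟨hn, x, hx, hadj⟩
  by_contra hnU
  exact hn (AvoidReachable.trans hx (.of_adj hadj.symm hx.notMem_right hnU))

variable (G)

/-- `P` is a connected subset of `D` of cardinality at most `κ` that contains a neighbor of every
vertex of the boundary of `D`. -/
structure IsCore (κ : Cardinal.{u}) (D P : Set V) : Prop where
  subset : P ⊆ D
  connected : (G.induce P).Connected
  card_le : #P ≤ κ
  exists_adj : ∀ n ∈ outerBoundary G D, ∃ x ∈ P, G.Adj n x

variable {G}

theorem exists_isCore {κ : Cardinal.{u}} (hκ : ℵ₀ ≤ κ) {U : Set V} {v : V} (hv : v ∉ U)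
    (hb : #(outerBoundary G (avoidComponent G U v)) ≤ κ) :
    ∃ P, IsCore G κ (avoidComponent G U v) P := by
  set N := outerBoundary G (avoidComponent G U v)
  choose x hx hadj using fun n : N => n.2.2
  choose p hp using hx
  -- One walk from `v` per boundary vertex; `{v}` keeps the set nonempty when the boundary is empty.
  refine ⟨{v} ∪ ⋃ n, {y | y ∈ (p n).support}, ?_, ?_, ?_, ?_⟩
  · rintro y (rfl | hy)
    · exact .refl hv
    · obtain ⟨n, hn⟩ := Set.mem_iUnion.1 hy
      exact .of_mem_support (p n) (hp n) hn
  · refine SimpleGraph.induce_connected_of_patches v (.inl rfl) fun {w} hw => ?_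
    rcases hw with rfl | hw
    · exact ⟨{w}, by simp, rfl, rfl, .rfl⟩
    · obtain ⟨n, hn⟩ := Set.mem_iUnion.1 hw
      exact ⟨{y | y ∈ (p n).support}, fun y hy => .inr (Set.mem_iUnion.2 ⟨n, hy⟩),
        (p n).start_mem_support, hn, (p n).connected_induce_support.preconnected _ _⟩
  · refine (mk_union_le _ _).trans (add_le_of_le hκ ?_ ?_)
    · rw [mk_singleton]
      exact one_le_aleph0.trans hκ
    · refine (mk_iUnion_le _).trans (mul_le_of_le hκ hb (ciSup_le' fun n => ?_))
      exact ((List.finite_toSet _).lt_aleph0.le).trans hκ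
  · intro n hn
    exact ⟨x ⟨n, hn⟩, .inr (Set.mem_iUnion.2 ⟨⟨n, hn⟩, (p _).end_mem_support⟩), hadj ⟨n, hn⟩⟩

variable (G)

open Classical in
/-- A chosen core of `D`, or the empty set if there is none. -/
noncomputable def core (κ : Cardinal.{u}) (D : Set V) : Set V :=
  if h : ∃ P, IsCore G κ D P then h.choose else ∅

variable {G}

theorem core_subset (κ : Cardinal.{u}) (D : Set V) : core G κ D ⊆ D := by
  rw [core]
  split_ifs with h
  · exact h.choose_spec.subset
  · exact Set.empty_subset _

theorem isCore_core {κ : Cardinal.{u}} {D : Set V} (h : ∃ P, IsCore G κ D P) :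
    IsCore G κ D (core G κ D) := by
  rw [core, dif_pos h]
  exact h.choose_spec

variable (G)

/-- The vertices removed before stage `i` when at each stage one removes from every component of
the remaining graph a core of this component. -/
noncomputable def removed (κ : Cardinal.{u}) (i : SuccIndex κ) : Set V :=
  {v | ∃ j, ∃ _ : j < i, v ∈ core G κ (avoidComponent G (removed κ j) v)}
termination_by i

/-- The core, at stage `i`, of the component of `v`. -/
noncomputable def piece (κ : Cardinal.{u}) (i : SuccIndex κ) (v : V) : Set V :=
  core G κ (avoidComponent G (removed G κ i) v)

variable {G} {κ : Cardinal.{u}}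

theorem mem_removed {i : SuccIndex κ} {v : V} :
    v ∈ removed G κ i ↔ ∃ j < i, v ∈ piece G κ j v := by
  rw [removed]
  simp [piece]

theorem removed_mono {i j : SuccIndex κ} (h : i ≤ j) : removed G κ i ⊆ removed G κ j := by
  intro v hv
  obtain ⟨k, hk, hv⟩ := mem_removed.1 hv
  exact mem_removed.2 ⟨k, hk.trans_le h, hv⟩

theorem avoidReachable_of_mem_piece {i : SuccIndex κ} {v w : V} (h : w ∈ piece G κ i v) :
    AvoidReachable G (removed G κ i) v w :=
  show w ∈ avoidComponent G (removed G κ i) v from core_subset κ _ h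

theorem piece_eq {i : SuccIndex κ} {v w : V} (h : AvoidReachable G (removed G κ i) v w) :
    piece G κ i v = piece G κ i w := by
  rw [piece, avoidComponent_eq h, piece]

/-- `w ∈ piece G κ i w` expresses that `w` is removed at stage `i`. -/
theorem mem_piece_self_of_mem_piece {i : SuccIndex κ} {v w : V} (h : w ∈ piece G κ i v) :
    w ∈ piece G κ i w :=
  piece_eq (avoidReachable_of_mem_piece h) ▸ h

theorem eq_of_mem_piece {i j : SuccIndex κ} {v : V} (hi : v ∈ piece G κ i v)
    (hj : v ∈ piece G κ j v) : i = j := by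
  rcases lt_trichotomy i j with h | h | h
  · exact absurd (mem_removed.2 ⟨i, h, hi⟩) (avoidReachable_of_mem_piece hj).notMem_left
  · exact h
  · exact absurd (mem_removed.2 ⟨j, h, hj⟩) (avoidReachable_of_mem_piece hi).notMem_left

/-- A boundary vertex removed at stage `j < i` was then in the component of `v`, so the boundary is
covered by at most `κ` pieces, each of size at most `κ` by induction. -/
theorem isCore_piece (hκ : ℵ₀ ≤ κ) (i : SuccIndex κ) :
    ∀ {v : V}, v ∉ removed G κ i →
      IsCore G κ (avoidComponent G (removed G κ i) v) (piece G κ i v) := by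
  induction i using WellFoundedLT.induction with
  | ind i ih =>
    intro v hv
    refine isCore_core (exists_isCore hκ hv ?_)
    have hsub : outerBoundary G (avoidComponent G (removed G κ i) v) ⊆
        ⋃ j ∈ Set.Iio i, piece G κ j v := by
      intro n hn
      obtain ⟨j, hj, hnj⟩ := mem_removed.1 (outerBoundary_avoidComponent_subset _ _ hn)
      obtain ⟨-, x, hx, hadj⟩ := hn
      refine Set.mem_iUnion₂.2 ⟨j, hj, ?_⟩
      have hvx := AvoidReachable.mono (removed_mono hj.le) hx
      rw [piece_eq (hvx.trans (.of_adj hadj.symm hvx.notMem_right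
        (avoidReachable_of_mem_piece hnj).notMem_left))]
      exact hnj
    refine (mk_le_mk_of_subset hsub).trans ((mk_biUnion_le _ _).trans
      (mul_le_of_le hκ (mk_Iio_succIndex_le i) (ciSup_le' fun j => ?_)))
    exact (ih j.1 j.2 fun h => hv (removed_mono j.2.le h)).card_le

end Avoiding

/-! ### The minor and the tree order -/

section NormalOrder

variable {V : Type u} {G : SimpleGraph V} {κ : Cardinal.{u}}

/-- A decreasing sequence of components of the remaining graphs gives a complete minor on `κ⁺`
vertices. -/
theorem isMinor_of_avoidReachable (hκ : ℵ₀ ≤ κ) (d : SuccIndex κ → V)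
    (hd : ∀ i j, i ≤ j → AvoidReachable G (removed G κ i) (d i) (d j)) :
    IsMinor (completeGraphCard (Order.succ κ)) G := by
  have hcore (i : SuccIndex κ) := isCore_piece hκ i (hd i i le_rfl).notMem_left
  let A (j i : SuccIndex κ) : Prop :=
    ∃ n ∈ piece G κ j (d j), ∃ x, AvoidReachable G (removed G κ i) (d i) x ∧ G.Adj n x
  have hAmono {j i i' : SuccIndex κ} (hii' : i ≤ i') (h : A j i') : A j i := by
    obtain ⟨n, hn, x, hx, hadj⟩ := h
    exact ⟨n, hn, x, (hd i i' hii').trans (hx.mono (removed_mono hii')), hadj⟩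
  have hmem {j i : SuccIndex κ} (hji : j < i) {n : V} (hn : n ∈ piece G κ j (d j)) :
      n ∈ removed G κ i := mem_removed.2 ⟨j, hji, mem_piece_self_of_mem_piece hn⟩
  -- every component is adjacent to earlier pieces of arbitrarily late stages
  have hcof {j i : SuccIndex κ} (hji : j < i) : ∃ k, j ≤ k ∧ k < i ∧ A k i := by
    obtain ⟨⟨q, hq⟩⟩ := (hcore j).connected.nonempty
    -- A walk from `d i` to the piece of stage `j` leaves the component of stage `i` through a
    -- vertex removed at some stage in `[j, i)`.
    obtain ⟨p, hp⟩ := (hd j i hji.le).symm.trans (avoidReachable_of_mem_piece hq)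
    obtain ⟨e, he, hx, hy⟩ := p.exists_boundary_dart
      (avoidComponent G (removed G κ i) (d i)) (hd i i le_rfl)
      fun h => AvoidReachable.notMem_right h (hmem hji hq)
    have hx : AvoidReachable G (removed G κ i) (d i) e.fst := hx
    have hyi : e.snd ∈ removed G κ i := by
      by_contra hyi
      exact hy (hx.trans (.of_adj e.adj hx.notMem_right hyi))
    obtain ⟨k, hki, hk⟩ := mem_removed.1 hyi
    refine ⟨k, ?_, hki, e.snd, ?_, e.fst, hx, e.adj.symm⟩
    · by_contra hkj
      exact hp _ (p.dart_snd_mem_support_of_mem_darts he)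
        (mem_removed.2 ⟨k, lt_of_not_ge hkj, hk⟩)
    · have h1 := (hd k i hki.le).trans (hx.mono (removed_mono hki.le))
      rwa [piece_eq (h1.trans (.of_adj e.adj h1.notMem_right
        (avoidReachable_of_mem_piece hk).notMem_left))]
  -- Pieces with index in `J` touch all later components, and hence, by the core property, all later
  -- pieces.
  let J : Set (SuccIndex κ) := {j | ∀ i, j < i → A j i}
  have hJ (j₀ : SuccIndex κ) : ∃ j ∈ J, j₀ ≤ j := by
    by_contra! hno
    have hb (j : SuccIndex κ) : ∃ i, j < i ∧ (j₀ ≤ j → ¬ A j i) := by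
      by_cases hj : j ∈ J
      · obtain ⟨i, hi⟩ := exists_gt_of_mk_le (s := {j}) hκ
          (by rw [mk_singleton]; exact one_le_aleph0.trans hκ)
        exact ⟨i, hi j rfl, fun h => absurd (hno j hj) (not_lt.2 h)⟩
      · simp only [J, Set.mem_ofPred_eq, not_forall] at hj
        obtain ⟨i, hi, hA⟩ := hj
        exact ⟨i, hi, fun _ => hA⟩
    choose b hb hbA using hb
    have hs (i : SuccIndex κ) : ∃ i', ∀ j ≤ i, b j < i' := by
      -- Since `i < b i`, the segment below `b i` contains every `j ≤ i`.
      obtain ⟨i', hi'⟩ := exists_gt_of_mk_le (s := b '' Set.Iio (b i)) hκ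
        (mk_image_le.trans (mk_Iio_succIndex_le _))
      exact ⟨i', fun j hj => hi' _ ⟨j, hj.trans_lt (hb i), rfl⟩⟩
    choose s hs using hs
    let t (n : ℕ) : SuccIndex κ := s^[n] j₀
    obtain ⟨i₁, hi₁⟩ := exists_gt_of_mk_le (s := Set.range t) hκ
      ((mk_le_aleph0_iff.2 (Set.countable_range t)).trans hκ)
    -- This `i` is closed under `b`: adjacency to the component of `i` fails for every stage in
    -- `[j₀, i)`, against `hcof`.
    obtain ⟨i, hi, hmin⟩ := _root_.wellFounded_lt.has_min {i | ∀ n, t n < i} ⟨i₁, fun n => hi₁ _ ⟨n, rfl⟩⟩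
    obtain ⟨k, hjk, hki, hA⟩ := hcof (hi 0)
    obtain ⟨n, hn⟩ : ∃ n, k ≤ t n := by
      by_contra! hlt
      exact hmin k hlt hki
    have hlt : b k < t (n + 1) := by
      simp only [t, Function.iterate_succ_apply']
      exact hs _ k hn
    exact hbA k hjk (hAmono (hlt.trans (hi _)).le hA)
  have hcard : #(SuccIndex κ) ≤ #J := by
    rw [mk_ord_toType, Order.succ_le_iff]
    by_contra hle
    obtain ⟨i, hi⟩ := exists_gt_of_mk_le hκ (not_lt.1 hle)
    obtain ⟨j, hj, hij⟩ := hJ i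
    exact (hi j hj).not_ge hij
  obtain ⟨e⟩ := hcard
  have hdisj {i j : SuccIndex κ} (hij : i < j) :
      Disjoint (piece G κ i (d i)) (piece G κ j (d j)) :=
    Set.disjoint_left.2 fun x hxi hxj =>
      (avoidReachable_of_mem_piece hxj).notMem_right (hmem hij hxi)
  have hadj {i j : SuccIndex κ} (hi : i ∈ J) (hij : i < j) :
      ∃ x ∈ piece G κ i (d i), ∃ y ∈ piece G κ j (d j), G.Adj x y := by
    obtain ⟨n, hn, x, hx, hnx⟩ := hi j hij
    obtain ⟨y, hy, hny⟩ := (hcore j).exists_adj n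
      ⟨fun h => AvoidReachable.notMem_right h (hmem hij hn), x, hx, hnx⟩
    exact ⟨n, hn, y, hy, hny⟩
  refine ⟨fun a => piece G κ (e a) (d (e a)), fun a b hab => ?_, fun a => (hcore _).connected,
    fun a b hab => ?_⟩
  · rcases lt_or_gt_of_ne (fun h => hab (e.injective (Subtype.ext h)) : (e a).1 ≠ (e b).1) with h | h
    · exact hdisj h
    · exact (hdisj h).symm
  · have hab : a ≠ b := hab
    rcases lt_or_gt_of_ne (fun h => hab (e.injective (Subtype.ext h)) : (e a).1 ≠ (e b).1) with h | h
    · exact hadj (e a).2 h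
    · obtain ⟨x, hx, y, hy, hxy⟩ := hadj (e b).2 h
      exact ⟨y, hy, x, hx, hxy.symm⟩

/-- The components of a vertex that is never removed form a decreasing sequence of length `κ⁺`. -/
theorem exists_mem_piece (hκ : ℵ₀ ≤ κ)
    (hG : ¬ IsMinor (completeGraphCard (Order.succ κ)) G) (v : V) : ∃ i, v ∈ piece G κ i v := by
  by_contra! h
  refine hG (isMinor_of_avoidReachable hκ (fun _ => v) fun i j _ => .refl fun hv => ?_)
  obtain ⟨k, -, hk⟩ := mem_removed.1 hv
  exact h k hk

/-- A family of relations that decreases along a well-order refines the well-order to a tree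
order. -/
theorem exists_orderTree {K : Type*} [LinearOrder K] [WellFoundedLT K] (key : V → K)
    (hkey : Function.Injective key) (r : K → V → V → Prop) (hrefl : ∀ v, r (key v) v v)
    (hsymm : ∀ k u v, r k u v → r k v u) (htrans : ∀ k u v w, r k u v → r k v w → r k u w)
    (hanti : ∀ k k' u v, k ≤ k' → r k' u v → r k u v) :
    ∃ _ : PartialOrder V, IsOrderTree V ∧ ∀ u v, u ≤ v ↔ key u ≤ key v ∧ r (key u) u v := by
  let inst : PartialOrder V :=
    { le u v := key u ≤ key v ∧ r (key u) u v
      le_refl v := ⟨le_rfl, hrefl v⟩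
      le_trans u v w huv hvw :=
        ⟨huv.1.trans hvw.1, htrans _ _ _ _ huv.2 (hanti _ _ _ _ huv.1 hvw.2)⟩
      le_antisymm u v huv hvu := hkey (huv.1.antisymm hvu.1) }
  have hle (u v : V) : u ≤ v ↔ key u ≤ key v ∧ r (key u) u v := Iff.rfl
  refine ⟨inst, ⟨fun t => ?_⟩, hle⟩
  have hcomp {a b : V} (ha : a ≤ t) (hb : b ≤ t) (h : key a ≤ key b) : a ≤ b :=
    ⟨h, htrans _ _ _ _ ha.2 (hanti _ _ _ _ h (hsymm _ _ _ hb.2))⟩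
  have hmono {a b : V} (hab : a < b) : key a < key b :=
    hab.le.1.lt_of_ne fun h => hab.ne (hkey h)
  exact
    { wf := Subrelation.wf (fun {a b} (hab : a.1 < b.1) => hmono hab)
        (InvImage.wf (fun a : Set.Iio t => key a.1) _root_.wellFounded_lt)
      trichotomous := by
        intro a b hab hba
        rcases le_total (key a.1) (key b.1) with h | h
        · exact Subtype.ext ((hcomp a.2.le b.2.le h).eq_or_lt.resolve_right hab)
        · exact Subtype.ext ((hcomp b.2.le a.2.le h).eq_or_lt.resolve_right hba).symm }

/-- A graph without a complete minor on `κ⁺` vertices has a tree order on its vertices without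
chains of cardinality `κ⁺` in which adjacent vertices are comparable. -/
theorem exists_normal_orderTree (hκ : ℵ₀ ≤ κ)
    (hG : ¬ IsMinor (completeGraphCard (Order.succ κ)) G) :
    ∃ _ : PartialOrder V, IsOrderTree V ∧ (∀ u v, G.Adj u v → u ≤ v ∨ v ≤ u) ∧
      ∀ C : Set V, IsChain (· ≤ ·) C → #C ≤ κ := by
  choose rk hrk using exists_mem_piece hκ hG
  have hnot {i : SuccIndex κ} {v : V} : v ∉ removed G κ i ↔ i ≤ rk v := by
    rw [mem_removed, ← not_lt, not_iff_not]
    exact ⟨fun ⟨j, hj, hv⟩ => eq_of_mem_piece hv (hrk v) ▸ hj, fun h => ⟨_, h, hrk v⟩⟩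
  -- An arbitrary well-order breaks ties between vertices removed at the same stage.
  let key (v : V) : SuccIndex κ ×ₗ Ordinal.{u} :=
    toLex (rk v, Ordinal.typein WellOrderingRel v)
  have hkey : Function.Injective key := fun a b h =>
    Ordinal.typein_injective WellOrderingRel (congrArg (fun x => (ofLex x).2) h)
  have hfst {a b : SuccIndex κ ×ₗ Ordinal.{u}} (h : a ≤ b) : (ofLex a).1 ≤ (ofLex b).1 :=
    (Prod.Lex.le_iff.1 h).elim le_of_lt fun h => h.1.le
  obtain ⟨inst, htree, hle⟩ := exists_orderTree key hkey
    (fun k => AvoidReachable G (removed G κ (ofLex k).1)) (fun v => .refl (hnot.2 le_rfl))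
    (fun _ _ _ => .symm) (fun _ _ _ _ => .trans)
    fun _ _ _ _ h => .mono (removed_mono (hfst h))
  have hle' {u v : V} (h : u ≤ v) : AvoidReachable G (removed G κ (rk u)) u v := ((hle u v).1 h).2
  refine ⟨inst, htree, fun u v huv => ?_, fun C hC => ?_⟩
  · rcases le_total (key u) (key v) with h | h
    · exact .inl ((hle _ _).2 ⟨h, .of_adj huv (hnot.2 le_rfl) (hnot.2 (hfst h))⟩)
    · exact .inr ((hle _ _).2 ⟨h, .of_adj huv.symm (hnot.2 le_rfl) (hnot.2 (hfst h))⟩)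
  · have hcomp {u v : V} (hu : u ∈ C) (hv : v ∈ C) {i : SuccIndex κ} (hiu : i ≤ rk u)
        (hiv : i ≤ rk v) : AvoidReachable G (removed G κ i) u v := by
      rcases hC.total hu hv with h | h
      · exact (hle' h).mono (removed_mono hiu)
      · exact ((hle' h).mono (removed_mono hiv)).symm
    -- A chain with unbounded ranks would pick out a decreasing sequence of components.
    obtain ⟨i, hi⟩ : ∃ i, ∀ v ∈ C, rk v < i := by
      by_contra! h
      choose d hd hid using h
      exact hG (isMinor_of_avoidReachable hκ d fun i j hij =>
        hcomp (hd i) (hd j) (hid i) (hij.trans (hid j)))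
    -- Elements of `C` of equal rank share a component at that stage, so they lie in one piece.
    have hsub : C ⊆ ⋃ j ∈ Set.Iio i, {v | v ∈ C ∧ rk v = j} := fun v hv =>
      Set.mem_iUnion₂.2 ⟨rk v, hi v hv, hv, rfl⟩
    refine (mk_le_mk_of_subset hsub).trans ((mk_biUnion_le _ _).trans
      (mul_le_of_le hκ (mk_Iio_succIndex_le i) (ciSup_le' fun j => ?_)))
    rcases Set.eq_empty_or_nonempty {v | v ∈ C ∧ rk v = j.1} with h | ⟨u, hu, huj⟩
    · rw [h]
      simp
    · refine (mk_le_mk_of_subset ?_).trans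
        (isCore_piece hκ j.1 (hnot.2 huj.ge : u ∉ removed G κ j.1)).card_le
      rintro v ⟨hv, hvj⟩
      rw [piece_eq (hcomp hu hv huj.ge hvj.ge), ← hvj]
      exact hrk v

end NormalOrder

end HadwigerTree

theorem mainTheorem1 (κ μ : Cardinal.{u}) (hκ : ℵ₀ ≤ κ) (hμ : ℵ₀ ≤ μ) :
    (∃ (V : Type u) (G : SimpleGraph V),
        #V = μ ∧
        HadwigerTree.chromaticCard G = Order.succ κ ∧
        ¬ HadwigerTree.IsMinor (HadwigerTree.completeGraphCard (Order.succ κ)) G) ↔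
    (∃ (T : Type u) (_ : PartialOrder T) (_ : HadwigerTree.IsOrderTree T),
        #T = μ ∧
        ¬ HadwigerTree.IsSpecial κ T ∧
        ∀ (b : Set T) (hb : HadwigerTree.IsBranch b),
          HadwigerTree.branchLength b hb < (Order.succ κ).ord) := by
  constructor
  · rintro ⟨V, G, hV, hχ, hG⟩
    obtain ⟨inst, htree, hadj, hchain⟩ := HadwigerTree.exists_normal_orderTree hκ hG
    refine ⟨V, inst, htree, hV, ?_, fun b hb =>
      (HadwigerTree.branchLength_lt_ord_iff hb).2 (Order.lt_succ_iff.2 (hchain b hb.isChain))⟩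
    rintro ⟨f, hf⟩
    have c : G.Coloring κ.ord.ToType := SimpleGraph.Coloring.mk f fun {u v} huv hfuv =>
      huv.ne ((hadj u v huv).elim
        (fun h => hf {u, v} (IsChain.pair h) (by simp) (by simp) hfuv)
        fun h => (hf {v, u} (IsChain.pair h) (by simp) (by simp) hfuv.symm).symm)
    have hle := (HadwigerTree.nonempty_coloring_iff G).1 ⟨c⟩
    exact absurd (hχ ▸ hle) (not_le.2 (Order.lt_succ κ))
  · rintro ⟨T, inst, htree, hT, hs, hb⟩
    have hchain {C : Set T} (hC : IsChain (· ≤ ·) C) : #C ≤ κ :=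
      HadwigerTree.mk_chain_le_of_branchLength_lt hb hC
    exact ⟨T, HadwigerTree.comparabilityGraph T, hT,
      HadwigerTree.chromaticCard_comparabilityGraph hκ hs fun t =>
        hchain (HadwigerTree.isChain_Iio t),
      HadwigerTree.not_isMinor_comparabilityGraph fun C => hchain⟩
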